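/- Let $N\ge 0$ be the number of reflecting elements and $N_r$ the number of receive antennas, and let $E_s>0$, $N_0\ge 0$. Let the channel gains $h_{l,i}$ ($1\le l\le N_r$, $1\le i\le N$) be i.i.d. $\mathcal{CN}(0,1)$ and the noises $n_l$ ($1\le l\le N_r$) be i.i.d. $\mathcal{CN}(0,N_0)$, all of them mutually independent (in $\mathcal{CN}(0,v)$ the real and imaginary parts are independent $\mathcal N(0,v/2)$). Let $m$ and $n$ be the antennas selected for the real and the imaginary part, and let $\hat m$ be the antenna detected for the real part. Put $A_i=\Re h_{m,i}$, $B_i=\Im h_{n,i}$, $C_i=-\Im h_{m,i}$, $D_i=\Re h_{n,i}$, and let the reflection coefficients be $$\theta_i=\frac{(A_i+B_i)+j\,(C_i+D_i)}{\sqrt{(A_i+B_i)^2+(C_i+D_i)^2}}$$ (the coefficients given by the value $\lambda_1=\tfrac12$ of the dual variable). Let $Y_i=\Re(h_{m,i}\theta_i)$, $\hat Y_i=\Re(h_{\hat m,i}\theta_i)$, and $$Z_1=\sqrt{E_s}\sum_{i=1}^N Y_i+\Re n_m,\qquad Z_2=\sqrt{E_s}\sum_{i=1}^N\hat Y_i+\Re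 n_{\hat m}.$$ Suppose that $m\ne n$ and $\hat m=n$ (case (ii)). Then: 1. For all $N$ and $i$, $$\hat Y_i=\frac{D_i(A_i+B_i)-B_i(C_i+D_i)}{\sqrt{(A_i+B_i)^2+(C_i+D_i)^2}},\qquad \mathbb E[\hat Y_i]=0,\qquad \operatorname{Var}[\hat Y_i]=\tfrac14 .$$ 2. For every $N$, $\;Z_2\sim\mathcal N\!\left(0,\ \dfrac{NE_s}{4}+\dfrac{N_0}{2}\right)$ exactly. 3. For every $N$, $Z_1$ is square-integrable with $$\mathbb E[Z_1]=\frac{N\sqrt{\pi E_s}}{2\sqrt2},\qquad \operatorname{Var}[Z_1]=\frac{N(6-\pi)E_s}{8}+\frac{N_0}{2},$$ and $Z_1$ is asymptotically normal with this mean and variance: for fixed $E_s$ and $N_0$, $\;(Z_1-\mathbb E[Z_1])/\sqrt{\operatorname{Var}[Z_1]}$ converges in distribution to $\mathcal N(0,1)$ as $N\to\infty$. -/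

import Mathlib

open MeasureTheory ProbabilityTheory Filter
open scoped NNReal ENNReal

noncomputable section

namespace RISRQSSK

/-- The circularly symmetric complex normal law `𝒞𝒩(0, v)`: real and imaginary parts are
independent real normal variables with mean `0` and variance `v / 2`. -/
def complexNormal (v : ℝ≥0) : Measure ℂ :=
  ((gaussianReal 0 (v / 2)).prod (gaussianReal 0 (v / 2))).map
    Complex.measurableEquivRealProd.symm

/-- The random data of a link with `N` reflecting elements and `Nr` receive antennas: the entries
`h l i` of the channel matrix are i.i.d. `𝒞𝒩(0, 1)`, the noises `w l` are i.i.d. `𝒞𝒩(0, N₀)`, and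
all of them are mutually independent. -/
structure IsLink {Ω : Type*} [MeasurableSpace Ω] {Nr N : ℕ} (N₀ : ℝ≥0)
    (h : Fin Nr → Fin N → Ω → ℂ) (w : Fin Nr → Ω → ℂ) (μ : Measure Ω) : Prop where
  channel_law : ∀ l i, HasLaw (h l i) (complexNormal 1) μ
  noise_law : ∀ l, HasLaw (w l) (complexNormal N₀) μ
  indep : iIndepFun (Sum.elim (fun p : Fin Nr × Fin N => h p.1 p.2) w) μ

/-- The reflection coefficient of a reflecting element whose channel gain is `a` to the antenna
selected for the real part and `b` to the antenna selected for the imaginary part, as a function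
of the dual variable `lam`. With `A = a.re`, `B = b.im`, `C = -a.im`, `D = b.re` it is the vector
`(lam A + (1 - lam) B, lam C + (1 - lam) D)` divided by its Euclidean norm. -/
def reflCoeff (lam : ℝ) (a b : ℂ) : ℂ :=
  let u : ℝ := lam * a.re + (1 - lam) * b.im
  let v : ℝ := lam * (-a.im) + (1 - lam) * b.re
  ⟨u / √(u ^ 2 + v ^ 2), v / √(u ^ 2 + v ^ 2)⟩

/-- The contribution of the `i`-th reflecting element to the real part of the signal at antenna
`l`, when antennas `m` and `n` are selected for the real and the imaginary part and `lam = 1 / 2`.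
For `l = m` this is `Y_i` and for `l = m̂` it is `Ŷ_i`. -/
def gain {Ω : Type*} {Nr N : ℕ} (h : Fin Nr → Fin N → Ω → ℂ) (m n l : Fin Nr) (i : Fin N)
    (ω : Ω) : ℝ :=
  (h l i ω * reflCoeff (1 / 2) (h m i ω) (h n i ω)).re

/-- The real part of the receive signal `y_l = √Es ∑ i, h_{l,i} θ_i + w_l` at antenna `l`.
For `l = m` this is `Z₁` and for `l = m̂` it is `Z₂`. -/
def received {Ω : Type*} {Nr N : ℕ} (Es : ℝ≥0) (h : Fin Nr → Fin N → Ω → ℂ)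
    (w : Fin Nr → Ω → ℂ) (m n l : Fin Nr) (ω : Ω) : ℝ :=
  √(Es : ℝ) * ∑ i, gain h m n l i ω + (w l ω).re

end RISRQSSK

end

namespace RISRQSSK

open Complex (I)
open scoped Topology

/-! For one reflecting element with gains `a = h_m` and `b = h_n`, put `W = conj a + I * conj b` and
`V = conj a - I * conj b`. Up to the factor `√2` this is an orthogonal change of coordinates, so `W`
and `V` are independent `𝒞𝒩(0, 2)`. The reflection coefficient is the phase `θ = W / |W|`. By
circular symmetry `U = conj V * θ` is again `𝒞𝒩(0, 2)` and independent of `W` (`hasLaw_cophase`).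
Solving for `a` and `b` gives `a * θ = (|W| + U) / 2` and `b * θ = I * (|W| - U) / 2`.

Hence `Y_i = |W| / 2 + Re U / 2`, a Rayleigh variable plus an independent normal one, while `Ŷ_i =
Im U / 2` is exactly `N(0, 1/4)`. The moments of `Y_i` follow from the Rayleigh mean `√(π/2)` and
second moment `2`.

Different elements and the noise use disjoint blocks of an independent family
(`IsLink.iIndepFun_summand`), so the characteristic function of the received signal is a product
(`IsLink.charFun_received`). For `Z₂` this product is that of a normal law; for `Z₁` a second-order
Taylor expansion gives the limit (`tendsto_charFun_centered_pow`), the noise factor tending to `1`.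
-/

/-! ### The complex normal law: characteristic function and symmetries. -/

instance (v : ℝ≥0) : IsProbabilityMeasure (complexNormal v) :=
  Measure.isProbabilityMeasure_map (MeasurableEquiv.measurable _).aemeasurable

lemma charFunDual_complexNormal (v : ℝ≥0) (K : StrongDual ℝ ℂ) :
    charFunDual (complexNormal v) K
      = Complex.exp (((-(v / 4 : ℝ) * (K 1 ^ 2 + K I ^ 2) : ℝ) : ℂ)) := by
  have hK (p : ℝ × ℝ) : K (Complex.measurableEquivRealProd.symm p) = K 1 * p.1 + K I * p.2 := by
    have : Complex.measurableEquivRealProd.symm p = p.1 • (1 : ℂ) + p.2 • I := by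
      apply Complex.ext <;> simp [Complex.measurableEquivRealProd]
    rw [this, map_add, map_smul, map_smul, smul_eq_mul, smul_eq_mul]
    ring
  rw [charFunDual_apply, complexNormal, integral_map_equiv]
  simp_rw [hK, Complex.ofReal_add, add_mul, Complex.exp_add, Complex.ofReal_mul]
  rw [integral_prod_mul (f := fun x : ℝ ↦ Complex.exp (((K 1 : ℝ) : ℂ) * x * I))
    (g := fun x : ℝ ↦ Complex.exp (((K I : ℝ) : ℂ) * x * I)), ← charFun_apply_real,
    ← charFun_apply_real, charFun_gaussianReal, charFun_gaussianReal, ← Complex.exp_add]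
  congr 1
  push_cast
  ring

lemma hasLaw_re_complexNormal (v : ℝ≥0) :
    HasLaw Complex.re (gaussianReal 0 (v / 2)) (complexNormal v) where
  aemeasurable := by fun_prop
  map_eq := by
    rw [complexNormal, Measure.map_map (by fun_prop) (MeasurableEquiv.measurable _)]
    exact measurePreserving_fst.map_eq

lemma hasLaw_im_complexNormal (v : ℝ≥0) :
    HasLaw Complex.im (gaussianReal 0 (v / 2)) (complexNormal v) where
  aemeasurable := by fun_prop
  map_eq := by
    rw [complexNormal, Measure.map_map (by fun_prop) (MeasurableEquiv.measurable _)]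
    exact measurePreserving_snd.map_eq

/-- Circular symmetry of the complex normal law, in the form needed for matched filtering. -/
lemma map_conj_mul_complexNormal (v : ℝ≥0) {θ : ℂ} (hθ : ‖θ‖ = 1) :
    (complexNormal v).map (fun z ↦ (starRingEnd ℂ) z * θ) = complexNormal v := by
  let T : ℂ →L[ℝ] ℂ := (ContinuousLinearMap.mul ℝ ℂ θ).comp Complex.conjCLE.toContinuousLinearMap
  have hT (z : ℂ) : T z = (starRingEnd ℂ) z * θ := by simp [T, mul_comm]
  have hK (K : StrongDual ℝ ℂ) (z : ℂ) : K z = z.re * K 1 + z.im * K I := by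
    have : z = z.re • (1 : ℂ) + z.im • I := by apply Complex.ext <;> simp
    conv_lhs => rw [this]
    rw [map_add, map_smul, map_smul, smul_eq_mul, smul_eq_mul]
  have hn : θ.re ^ 2 + θ.im ^ 2 = 1 := by
    have := Complex.sq_norm θ
    rw [hθ, Complex.normSq_apply] at this
    linarith
  simp_rw [← hT]
  refine Measure.ext_of_charFunDual (funext fun K ↦ ?_)
  rw [charFunDual_map, charFunDual_complexNormal, charFunDual_complexNormal]
  congr 2
  have hc (z : ℂ) : (K.comp T) z = K ((starRingEnd ℂ) z * θ) := congrArg K (hT z)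
  rw [hc, hc, hK K (_ * _), hK K (_ * _)]
  simp only [Complex.mul_re, Complex.mul_im, map_one, one_mul, Complex.conj_I, Complex.neg_re,
    Complex.neg_im, Complex.I_re, Complex.I_im, neg_zero, zero_mul]
  -- The functional composed with `T` takes the values `K θ` and `K (-I * θ)` at `1` and `I`; their
  -- squares sum to `‖θ‖ ^ 2 * (K 1 ^ 2 + K I ^ 2)`.
  linear_combination (-(v / 4 : ℝ) * (K 1 ^ 2 + K I ^ 2)) * hn

/-- The sum and the difference of the two rotated gains are again independent. -/
lemma map_sum_difference_complexNormal :
    ((complexNormal 1).prod (complexNormal 1)).map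
      (fun p : ℂ × ℂ ↦ ((starRingEnd ℂ) p.1 + I * (starRingEnd ℂ) p.2,
        (starRingEnd ℂ) p.1 - I * (starRingEnd ℂ) p.2))
      = (complexNormal 2).prod (complexNormal 2) := by
  let c : ℂ →L[ℝ] ℂ := Complex.conjCLE.toContinuousLinearMap
  let d : ℂ →L[ℝ] ℂ := (ContinuousLinearMap.mul ℝ ℂ I).comp c
  -- `T` is `√2` times an orthogonal map of `ℝ⁴`, so it doubles the quadratic form in the exponent;
  -- this turns the parameter `1` into `2`.
  let T : ℂ × ℂ →L[ℝ] ℂ × ℂ := (c.coprod d).prod (c.coprod (-d))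
  have hT (p : ℂ × ℂ) : T p = ((starRingEnd ℂ) p.1 + I * (starRingEnd ℂ) p.2,
      (starRingEnd ℂ) p.1 - I * (starRingEnd ℂ) p.2) := by
    simp [T, c, d, sub_eq_add_neg]
  simp_rw [← hT]
  refine Measure.ext_of_charFunDual (funext fun K ↦ ?_)
  rw [charFunDual_map, charFunDual_prod, charFunDual_prod]
  simp only [charFunDual_complexNormal, ← Complex.exp_add, ← Complex.ofReal_add]
  congr 2
  have hK (z w : ℂ) : K (z, w) = z.re * K (1, 0) + z.im * K (I, 0) + w.re * K (0, 1)
      + w.im * K (0, I) := by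
    have : (z, w) = z.re • ((1 : ℂ), (0 : ℂ)) + z.im • (I, (0 : ℂ)) + w.re • ((0 : ℂ), (1 : ℂ))
        + w.im • ((0 : ℂ), I) := by
      ext <;> simp
    conv_lhs => rw [this]
    simp only [map_add, map_smul, smul_eq_mul]
  simp only [ContinuousLinearMap.comp_apply, ContinuousLinearMap.inl_apply,
    ContinuousLinearMap.inr_apply, hT]
  rw [hK (_ + _) _, hK (_ + _) _, hK (_ + _) _, hK (_ + _) _]
  simp
  ring

/-! ### Rotated coordinates of a single reflecting element. -/

/-- The phase of a complex number, with the value `1` at `0`. -/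
noncomputable def phase (w : ℂ) : ℂ := if w = 0 then 1 else w / ‖w‖

lemma norm_phase (w : ℂ) : ‖phase w‖ = 1 := by
  unfold phase
  split_ifs with h
  · simp
  · simp [h]

@[fun_prop]
lemma measurable_phase : Measurable phase :=
  Measurable.ite (measurableSet_singleton 0) measurable_const (by fun_prop)

/-- The co-phased sum `W` of the two gains of a reflecting element, and their rotated difference
after multiplication by the phase of `W`. -/
noncomputable def cophase (p : ℂ × ℂ) : ℂ × ℂ :=
  let W := (starRingEnd ℂ) p.1 + I * (starRingEnd ℂ) p.2
  (W, (starRingEnd ℂ) ((starRingEnd ℂ) p.1 - I * (starRingEnd ℂ) p.2) * phase W)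

/-- Given the first coordinate, the second is a conjugated normal variable rotated by a fixed phase.
Its conditional law does not depend on that phase, so the skew product preserves the product
measure. -/
lemma hasLaw_cophase :
    HasLaw cophase ((complexNormal 2).prod (complexNormal 2))
      ((complexNormal 1).prod (complexNormal 1)) := by
  have h1 : MeasurePreserving (fun p : ℂ × ℂ ↦ ((starRingEnd ℂ) p.1 + I * (starRingEnd ℂ) p.2,
        (starRingEnd ℂ) p.1 - I * (starRingEnd ℂ) p.2))
      ((complexNormal 1).prod (complexNormal 1)) ((complexNormal 2).prod (complexNormal 2)) :=
    ⟨by fun_prop, map_sum_difference_complexNormal⟩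
  have h2 : MeasurePreserving (fun p : ℂ × ℂ ↦ (p.1, (starRingEnd ℂ) p.2 * phase p.1))
      ((complexNormal 2).prod (complexNormal 2)) ((complexNormal 2).prod (complexNormal 2)) :=
    (MeasurePreserving.id _).skew_product (g := fun w z ↦ (starRingEnd ℂ) z * phase w)
      (by unfold Function.uncurry; fun_prop)
      (.of_forall fun w ↦ map_conj_mul_complexNormal 2 (norm_phase w))
  exact (h2.comp h1).hasLaw

lemma norm_eq_conj_mul_phase (w : ℂ) : (‖w‖ : ℂ) = (starRingEnd ℂ) w * phase w := by
  rcases eq_or_ne w 0 with rfl | h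
  · simp
  have hpos : (‖w‖ : ℂ) ≠ 0 := by simpa using h
  rw [phase, if_neg h, mul_div_assoc', ← Complex.normSq_eq_conj_mul_self,
    Complex.normSq_eq_norm_sq, eq_div_iff hpos]
  push_cast
  ring

/-- At `lam = 1 / 2` the unnormalised vector is `W / 2`, and normalising removes the factor. At `W =
0` the conventions differ (`0` against `1`), hence the hypothesis, which holds almost surely. -/
lemma reflCoeff_eq_phase {a b : ℂ} (h : (cophase (a, b)).1 ≠ 0) :
    reflCoeff (1 / 2) a b = phase (cophase (a, b)).1 := by
  set W := (cophase (a, b)).1 with hW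
  have hre : W.re = a.re + b.im := by simp [hW, cophase]
  have him : W.im = -a.im + b.re := by simp [hW, cophase]
  have hnorm : √((1 / 2 * a.re + (1 - 1 / 2) * b.im) ^ 2
      + (1 / 2 * (-a.im) + (1 - 1 / 2) * b.re) ^ 2) = ‖W‖ / 2 := by
    rw [Complex.norm_def, Complex.normSq_apply, hre, him,
      show (2 : ℝ) = √(2 ^ 2) by simp, ← Real.sqrt_div' _ (by positivity)]
    congr 1
    ring
  have hpos : ‖W‖ ≠ 0 := by simpa using h
  rw [phase, if_neg h]
  simp only [reflCoeff]
  rw [hnorm]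
  apply Complex.ext
  · rw [Complex.div_ofReal_re, hre]; field_simp; ring
  · rw [Complex.div_ofReal_im, him]; field_simp; ring

/-- Since `a = conj ((W + V) / 2)`, multiplying by the phase of `W` turns the `W` part into `‖W‖`.
-/
lemma re_mul_reflCoeff_left {a b : ℂ} (h : (cophase (a, b)).1 ≠ 0) :
    (a * reflCoeff (1 / 2) a b).re = ‖(cophase (a, b)).1‖ / 2 + (cophase (a, b)).2.re / 2 := by
  rw [reflCoeff_eq_phase h]
  set W := (cophase (a, b)).1 with hW
  have key : a * phase W = (‖W‖ + (cophase (a, b)).2) / 2 := by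
    have h2 : (cophase (a, b)).2
        = (starRingEnd ℂ) ((starRingEnd ℂ) a - I * (starRingEnd ℂ) b) * phase W := rfl
    have hW' : W = (starRingEnd ℂ) a + I * (starRingEnd ℂ) b := rfl
    have hn := norm_eq_conj_mul_phase W
    rw [hn, h2, hW']
    simp
    ring
  rw [key]
  simp
  ring

/-- Here `b = I * conj (W - V) / 2`: the factor `I` makes the `‖W‖` term purely imaginary, so it
drops out of the real part. -/
lemma re_mul_reflCoeff_right {a b : ℂ} (h : (cophase (a, b)).1 ≠ 0) :
    (b * reflCoeff (1 / 2) a b).re = (cophase (a, b)).2.im / 2 := by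
  rw [reflCoeff_eq_phase h]
  set W := (cophase (a, b)).1 with hW
  have key : b * phase W = I * (‖W‖ - (cophase (a, b)).2) / 2 := by
    have h2 : (cophase (a, b)).2
        = (starRingEnd ℂ) ((starRingEnd ℂ) a - I * (starRingEnd ℂ) b) * phase W := rfl
    have hW' : W = (starRingEnd ℂ) a + I * (starRingEnd ℂ) b := rfl
    have hn := norm_eq_conj_mul_phase W
    rw [hn, h2, hW']
    simp
    ring_nf
    simp
  rw [key]
  simp

lemma ae_ne_zero_complexNormal {v : ℝ≥0} (hv : v ≠ 0) : ∀ᵐ w ∂complexNormal v, w ≠ 0 := by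
  have hv' : v / 2 ≠ 0 := by simpa using hv
  have := nullSingletonClass_gaussianReal (μ := 0) hv'
  have h : ∀ᵐ x ∂gaussianReal 0 (v / 2), x ≠ 0 := by simp [ae_iff]
  rw [← (hasLaw_re_complexNormal v).map_eq] at h
  filter_upwards [ae_of_ae_map (by fun_prop) h] with w hw
  rintro rfl
  simp at hw

lemma ae_cophase_fst_ne_zero :
    ∀ᵐ p ∂(complexNormal 1).prod (complexNormal 1), (cophase p).1 ≠ 0 := by
  have h : ∀ᵐ w ∂complexNormal 2, w ≠ 0 := ae_ne_zero_complexNormal two_ne_zero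
  have h' : ∀ᵐ q ∂(complexNormal 2).prod (complexNormal 2), q.1 ≠ 0 := by
    have := (measurePreserving_fst (μ := complexNormal 2) (ν := complexNormal 2)).map_eq
    rw [← this] at h
    exact ae_of_ae_map (p := fun w ↦ w ≠ 0) (by fun_prop) h
  rw [← hasLaw_cophase.map_eq] at h'
  exact ae_of_ae_map (p := fun q : ℂ × ℂ ↦ q.1 ≠ 0) hasLaw_cophase.aemeasurable h'

/-! ### Laws of the two gains. -/

/-- The law of the matched gain `Y_i`. -/
noncomputable def matchedLaw : Measure ℝ :=
  ((complexNormal 2).prod (complexNormal 2)).map (fun q ↦ ‖q.1‖ / 2 + q.2.re / 2)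

lemma hasLaw_matched :
    HasLaw (fun p : ℂ × ℂ ↦ (p.1 * reflCoeff (1 / 2) p.1 p.2).re) matchedLaw
      ((complexNormal 1).prod (complexNormal 1)) := by
  have h : HasLaw (fun q : ℂ × ℂ ↦ ‖q.1‖ / 2 + q.2.re / 2) matchedLaw
      ((complexNormal 2).prod (complexNormal 2)) := ⟨by fun_prop, rfl⟩
  refine (h.comp hasLaw_cophase).congr ?_
  filter_upwards [ae_cophase_fst_ne_zero] with p hp
  exact re_mul_reflCoeff_left hp

lemma hasLaw_mismatched :
    HasLaw (fun p : ℂ × ℂ ↦ (p.2 * reflCoeff (1 / 2) p.1 p.2).re) (gaussianReal 0 (1 / 4))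
      ((complexNormal 1).prod (complexNormal 1)) := by
  have h : HasLaw (fun q : ℂ × ℂ ↦ q.2.im / 2) (gaussianReal 0 (1 / 4))
      ((complexNormal 2).prod (complexNormal 2)) := by
    have := gaussianReal_div_const (((hasLaw_im_complexNormal 2).comp
      (measurePreserving_snd (μ := complexNormal 2) (ν := complexNormal 2)).hasLaw)) 2
    convert this using 2
    · simp
    · simp
    · apply NNReal.eq; norm_num
  refine (h.comp hasLaw_cophase).congr ?_
  filter_upwards [ae_cophase_fst_ne_zero] with p hp
  exact re_mul_reflCoeff_right hp

/-! ### Rayleigh moments and the moments of the matched gain. -/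

lemma complexNormal_two_eq_withDensity :
    complexNormal 2 = volume.withDensity
      (fun z : ℂ ↦ ENNReal.ofReal ((2 * Real.pi)⁻¹ * Real.exp (-(1 / 2) * ‖z‖ ^ (2 : ℝ)))) := by
  rw [complexNormal, show (2 : ℝ≥0) / 2 = 1 by simp, gaussianReal_of_var_ne_zero 0 one_ne_zero,
    prod_withDensity (by fun_prop) (by fun_prop), ← Measure.volume_eq_prod]
  rw [← Complex.volume_preserving_equiv_real_prod.map_eq]
  ext s hs
  rw [MeasurableEquiv.map_apply, withDensity_apply _ ((MeasurableEquiv.measurable _) hs),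
    withDensity_apply _ hs, setLIntegral_map ((MeasurableEquiv.measurable _) hs) (by fun_prop)
      (MeasurableEquiv.measurable _)]
  have : Complex.measurableEquivRealProd ⁻¹' (Complex.measurableEquivRealProd.symm ⁻¹' s) = s := by
    ext; simp
  rw [this]
  refine lintegral_congr fun z ↦ ?_
  simp only [gaussianPDF, gaussianPDFReal]
  rw [← ENNReal.ofReal_mul (by positivity)]
  congr 1
  have hz : ‖z‖ ^ (2 : ℝ) = z.re ^ 2 + z.im ^ 2 := by
    rw [Real.rpow_two, Complex.sq_norm, Complex.normSq_apply]; ring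
  have h2 : (√(2 * Real.pi))⁻¹ * (√(2 * Real.pi))⁻¹ = (2 * Real.pi)⁻¹ := by
    rw [← mul_inv, Real.mul_self_sqrt (by positivity)]
  simp only [Complex.measurableEquivRealProd_apply, NNReal.coe_one, mul_one, sub_zero]
  rw [mul_mul_mul_comm, h2, ← Real.exp_add, hz]
  congr 2
  ring

/-- The mean of the Rayleigh law with unit scale. -/
lemma integral_norm_complexNormal_two : ∫ z, ‖z‖ ∂complexNormal 2 = √(Real.pi / 2) := by
  rw [complexNormal_two_eq_withDensity, integral_withDensity_eq_integral_toReal_smul (by fun_prop)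
    (by simp)]
  have h := Complex.integral_rpow_mul_exp_neg_mul_rpow (p := 2) (q := 1) (b := 1 / 2)
    one_le_two (by norm_num) (by norm_num)
  have hG : Real.Gamma ((1 + 2) / 2) = √Real.pi / 2 := by
    rw [show ((1 : ℝ) + 2) / 2 = 1 / 2 + 1 by norm_num, Real.Gamma_add_one (by norm_num),
      Real.Gamma_one_half_eq]
    ring
  have hp : (1 / 2 : ℝ) ^ (-(1 + 2) / 2 : ℝ) = 2 * √2 := by
    rw [one_div, Real.inv_rpow (by norm_num), ← Real.rpow_neg (by norm_num),
      show (-(-(1 + 2) / 2) : ℝ) = 1 + 1 / 2 by norm_num, Real.rpow_add (by norm_num),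
      Real.rpow_one, Real.sqrt_eq_rpow]
  rw [hG, hp] at h
  calc ∫ z : ℂ, (ENNReal.ofReal ((2 * Real.pi)⁻¹ * Real.exp (-(1 / 2) * ‖z‖ ^ (2 : ℝ)))).toReal
        • ‖z‖
      = (2 * Real.pi)⁻¹ * ∫ z : ℂ, ‖z‖ ^ (1 : ℝ) * Real.exp (-(1 / 2) * ‖z‖ ^ (2 : ℝ)) := by
        rw [← integral_const_mul]
        refine integral_congr_ae (.of_forall fun z ↦ ?_)
        simp only [smul_eq_mul, Real.rpow_one]
        rw [ENNReal.toReal_ofReal (by positivity)]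
        ring
    _ = √(Real.pi / 2) := by
        rw [h, Real.sqrt_div' _ (by norm_num)]
        have h2 : √2 * √2 = 2 := Real.mul_self_sqrt (by norm_num)
        field_simp
        nlinarith

lemma memLp_re_complexNormal (v : ℝ≥0) : MemLp Complex.re 2 (complexNormal v) := by
  have h := memLp_id_gaussianReal (μ := 0) (v := v / 2) 2
  rw [← (hasLaw_re_complexNormal v).map_eq] at h
  exact h.comp_of_map (by fun_prop)

lemma memLp_im_complexNormal (v : ℝ≥0) : MemLp Complex.im 2 (complexNormal v) := by
  have h := memLp_id_gaussianReal (μ := 0) (v := v / 2) 2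
  rw [← (hasLaw_im_complexNormal v).map_eq] at h
  exact h.comp_of_map (by fun_prop)

lemma integral_re_complexNormal (v : ℝ≥0) : ∫ z, z.re ∂complexNormal v = 0 := by
  rw [(hasLaw_re_complexNormal v).integral_eq, integral_id_gaussianReal]

lemma variance_re_complexNormal (v : ℝ≥0) : Var[Complex.re; complexNormal v] = v / 2 := by
  rw [(hasLaw_re_complexNormal v).variance_eq, variance_id_gaussianReal]; simp

lemma memLp_norm_complexNormal (v : ℝ≥0) : MemLp (fun z : ℂ ↦ ‖z‖) 2 (complexNormal v) := by
  refine ((memLp_re_complexNormal v).norm.add (memLp_im_complexNormal v).norm).mono'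
    (by fun_prop) (.of_forall fun z ↦ ?_)
  simpa using Complex.norm_le_abs_re_add_abs_im z

lemma integral_norm_sq_complexNormal (v : ℝ≥0) : ∫ z, ‖z‖ ^ 2 ∂complexNormal v = v := by
  have hre : ∫ z : ℂ, z.re ^ 2 ∂complexNormal v = v / 2 := by
    have := (hasLaw_re_complexNormal v).variance_eq
    rw [variance_of_integral_eq_zero (by fun_prop) (integral_re_complexNormal v),
      variance_id_gaussianReal] at this
    simpa using this
  have him : ∫ z : ℂ, z.im ^ 2 ∂complexNormal v = v / 2 := by
    have := (hasLaw_im_complexNormal v).variance_eq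
    rw [variance_of_integral_eq_zero (by fun_prop) (by
      rw [(hasLaw_im_complexNormal v).integral_eq, integral_id_gaussianReal]),
      variance_id_gaussianReal] at this
    simpa using this
  have h (z : ℂ) : ‖z‖ ^ 2 = z.re ^ 2 + z.im ^ 2 := by
    rw [Complex.sq_norm, Complex.normSq_apply]; ring
  simp_rw [h]
  rw [integral_add (memLp_re_complexNormal v).integrable_sq (memLp_im_complexNormal v).integrable_sq,
    hre, him]
  ring

lemma variance_norm_complexNormal_two :
    Var[fun z ↦ ‖z‖; complexNormal 2] = 2 - Real.pi / 2 := by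
  rw [variance_eq_sub (memLp_norm_complexNormal 2), integral_norm_complexNormal_two,
    Real.sq_sqrt (by positivity)]
  have := integral_norm_sq_complexNormal 2
  simp only [Pi.pow_apply]
  rw [this]
  simp

lemma memLp_matched : MemLp (fun q : ℂ × ℂ ↦ ‖q.1‖ / 2 + q.2.re / 2) 2
    ((complexNormal 2).prod (complexNormal 2)) := by
  have h1 := (memLp_norm_complexNormal 2).comp_fst (ν := complexNormal 2)
  have h2 := (memLp_re_complexNormal 2).comp_snd (μ := complexNormal 2)
  have := (h1.mul_const (1 / 2)).add (h2.mul_const (1 / 2))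
  refine this.congr_norm (by fun_prop) (.of_forall fun q ↦ ?_)
  simp [div_eq_mul_inv]

instance : IsProbabilityMeasure matchedLaw :=
  Measure.isProbabilityMeasure_map (by fun_prop)

lemma memLp_id_matchedLaw : MemLp id 2 matchedLaw :=
  (memLp_map_measure_iff (by fun_prop) (by fun_prop)).2 memLp_matched

lemma integral_id_matchedLaw : ∫ x, x ∂matchedLaw = √Real.pi / (2 * √2) := by
  rw [matchedLaw, integral_map (by fun_prop) (by fun_prop)]
  have h1 := (memLp_norm_complexNormal 2).comp_fst (ν := complexNormal 2)
  have h2 := (memLp_re_complexNormal 2).comp_snd (μ := complexNormal 2)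
  rw [integral_add ((h1.integrable one_le_two).div_const 2)
    ((h2.integrable one_le_two).div_const 2), integral_div, integral_div]
  rw [integral_fun_fst (fun z : ℂ ↦ ‖z‖), integral_fun_snd (fun z : ℂ ↦ z.re),
    integral_norm_complexNormal_two, integral_re_complexNormal, Real.sqrt_div' _ (by norm_num)]
  simp
  field_simp

lemma variance_id_matchedLaw : Var[id; matchedLaw] = (6 - Real.pi) / 8 := by
  rw [matchedLaw, variance_map (by fun_prop) (by fun_prop), Function.id_comp]
  have h1 := (memLp_norm_complexNormal 2).mul_const (1 / 2)
  have h2 := (memLp_re_complexNormal 2).mul_const (1 / 2)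
  have h := variance_add_prod h1 h2
  rw [variance_mul_const, variance_mul_const, variance_norm_complexNormal_two,
    variance_re_complexNormal] at h
  simp only [div_eq_mul_inv, one_mul] at h ⊢
  rw [h]
  push_cast
  ring

/-! ### Independence of the noise and of the contributions of the elements. -/

/-- Disjoint blocks of an independent family are independent. -/
lemma iIndepFun_curry {Ω ι κ E : Type*} [MeasurableSpace Ω] [Fintype ι] [Fintype κ]
    [MeasurableSpace E] {μ : Measure Ω} {X : ι × κ → Ω → E} (hX : ∀ p, AEMeasurable (X p) μ)
    (h : iIndepFun X μ) : iIndepFun (fun i ω j ↦ X (i, j) ω) μ := by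
  have := h.isProbabilityMeasure
  have hP (p) : IsProbabilityMeasure (μ.map (X p)) := Measure.isProbabilityMeasure_map (hX p)
  rw [iIndepFun_iff_map_fun_eq_pi_map fun i ↦ aemeasurable_pi_lambda _ fun j ↦ hX (i, j)]
  have hrow (i : ι) : μ.map (fun ω j ↦ X (i, j) ω) = Measure.pi fun j ↦ μ.map (X (i, j)) :=
    (h.precomp (Prod.mk_right_injective i)).map_fun_eq_pi_map fun j ↦ hX (i, j)
  simp_rw [hrow]
  have hcurry : μ.map (fun ω i j ↦ X (i, j) ω)
      = (Measure.pi fun p ↦ μ.map (X p)).map (fun x i j ↦ x (i, j)) := by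
    rw [← h.map_fun_eq_pi_map hX, AEMeasurable.map_map_of_aemeasurable
      (Measurable.aemeasurable (by fun_prop)) (aemeasurable_pi_lambda _ hX)]
    rfl
  -- Product measures are determined by rectangles, and on these both sides are the same double
  -- product.
  have huncurry : (Measure.pi fun i ↦ Measure.pi fun j ↦ μ.map (X (i, j))).map
      (fun (x : ι → κ → E) (p : ι × κ) ↦ x p.1 p.2) = Measure.pi fun p ↦ μ.map (X p) := by
    refine (Measure.pi_eq fun s hs ↦ ?_).symm
    rw [Measure.map_apply (by fun_prop) (.univ_pi hs)]
    have : (fun (x : ι → κ → E) (p : ι × κ) ↦ x p.1 p.2) ⁻¹' Set.univ.pi s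
        = Set.univ.pi fun i ↦ Set.univ.pi fun j ↦ s (i, j) := by
      ext x; simp
    rw [this, Measure.pi_pi]
    simp_rw [Measure.pi_pi]
    rw [Fintype.prod_prod_type]
  rw [hcurry, ← huncurry, Measure.map_map (by fun_prop) (by fun_prop)]
  exact Measure.map_id

/-- The independent terms whose sum is the received signal: the noise and the contributions of
the reflecting elements. -/
noncomputable def summand {Ω : Type*} {Nr N : ℕ} (Es : ℝ≥0) (h : Fin Nr → Fin N → Ω → ℂ) (w : Fin Nr → Ω → ℂ)
    (m n l : Fin Nr) : Option (Fin N) → Ω → ℝ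
  | none => fun ω ↦ (w l ω).re
  | some i => fun ω ↦ √(Es : ℝ) * gain h m n l i ω

lemma received_eq_sum_summand {Ω : Type*} {Nr N : ℕ} (Es : ℝ≥0) (h : Fin Nr → Fin N → Ω → ℂ)
    (w : Fin Nr → Ω → ℂ) (m n l : Fin Nr) :
    received Es h w m n l = fun ω ↦ ∑ o, summand Es h w m n l o ω := by
  funext ω
  simp [received, summand, Finset.mul_sum, add_comm]

section Link

variable {Ω : Type*} [MeasurableSpace Ω] {Nr N : ℕ} {Es N₀ : ℝ≥0}
  {h : Fin Nr → Fin N → Ω → ℂ} {w : Fin Nr → Ω → ℂ} {μ : Measure Ω} {m n l : Fin Nr}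

lemma measurable_re_mul_reflCoeff (lam : ℝ) :
    Measurable (fun p : ℂ × ℂ × ℂ ↦ (p.1 * reflCoeff lam p.2.1 p.2.2).re) := by
  simp only [reflCoeff, Complex.mul_re]
  fun_prop

lemma IsLink.aemeasurable (hlink : IsLink N₀ h w μ) (q : (Fin Nr × Fin N) ⊕ Fin Nr) :
    AEMeasurable (Sum.elim (fun p : Fin Nr × Fin N ↦ h p.1 p.2) w q) μ := by
  rcases q with p | k
  · exact (hlink.channel_law p.1 p.2).aemeasurable
  · exact (hlink.noise_law k).aemeasurable

lemma IsLink.iIndepFun_summand (hlink : IsLink N₀ h w μ) (hmn : m ≠ n) (hl : l = m ∨ l = n) :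
    iIndepFun (summand Es h w m n l) μ := by
  let sel : Bool → Fin Nr := fun b ↦ bif b then n else m
  obtain ⟨β, hβ⟩ : ∃ β, sel β = l := by
    rcases hl with rfl | rfl
    · exact ⟨false, rfl⟩
    · exact ⟨true, rfl⟩
  -- The block `none` holds the noises at both selected antennas, although only the one at `l` is
  -- used: all blocks then have the same type `Bool → ℂ`.
  let idx : Option (Fin N) × Bool → (Fin Nr × Fin N) ⊕ Fin Nr := fun q ↦
    q.1.elim (.inr (sel q.2)) (fun i ↦ .inl (sel q.2, i))
  have hsel : Function.Injective sel := by
    rintro (_ | _) (_ | _) hb <;> simp_all [sel, eq_comm]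
  have hidx : Function.Injective idx := by
    rintro ⟨_ | i, b⟩ ⟨_ | i', b'⟩ hq <;> simp [idx] at hq ⊢
    · exact hsel hq
    · exact ⟨hq.2, hsel hq.1⟩
  have hind := iIndepFun_curry (fun q ↦ hlink.aemeasurable (idx q)) (hlink.indep.precomp hidx)
  let g : Option (Fin N) → (Bool → ℂ) → ℝ := fun o x ↦
    o.elim (x β).re (fun _ ↦ √(Es : ℝ) * (x β * reflCoeff (1 / 2) (x false) (x true)).re)
  have hg (o) : Measurable (g o) := by
    rcases o with _ | i
    · exact Complex.measurable_re.comp (measurable_pi_apply β)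
    · exact ((measurable_re_mul_reflCoeff (1 / 2)).comp
        (g := fun p : ℂ × ℂ × ℂ ↦ (p.1 * reflCoeff (1 / 2) p.2.1 p.2.2).re)
        (f := fun x : Bool → ℂ ↦ (x β, x false, x true)) (by fun_prop)).const_mul _
  convert hind.comp g hg using 1
  funext o ω
  rcases o with _ | i
  · simp [summand, g, idx, hβ]
  · simp [summand, g, idx, hβ, gain, sel]

/-! ### Characteristic function and moments of the received signal. -/

lemma IsLink.hasLaw_pair (hlink : IsLink N₀ h w μ) (hmn : m ≠ n) (i : Fin N) :
    HasLaw (fun ω ↦ (h m i ω, h n i ω)) ((complexNormal 1).prod (complexNormal 1)) μ := by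
  have := hlink.indep.isProbabilityMeasure
  have hi : IndepFun (h m i) (h n i) μ :=
    hlink.indep.indepFun (i := .inl (m, i)) (j := .inl (n, i)) (by simpa using hmn)
  exact hi.hasLaw_prod (hlink.channel_law m i) (hlink.channel_law n i)

lemma IsLink.hasLaw_gain_left (hlink : IsLink N₀ h w μ) (hmn : m ≠ n) (i : Fin N) :
    HasLaw (gain h m n m i) matchedLaw μ :=
  hasLaw_matched.comp (hlink.hasLaw_pair hmn i)

lemma IsLink.hasLaw_gain_right (hlink : IsLink N₀ h w μ) (hmn : m ≠ n) (i : Fin N) :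
    HasLaw (gain h m n n i) (gaussianReal 0 (1 / 4)) μ :=
  hasLaw_mismatched.comp (hlink.hasLaw_pair hmn i)

lemma IsLink.hasLaw_re_noise (hlink : IsLink N₀ h w μ) (l : Fin Nr) :
    HasLaw (fun ω ↦ (w l ω).re) (gaussianReal 0 (N₀ / 2)) μ :=
  (hasLaw_re_complexNormal N₀).comp (hlink.noise_law l)

lemma IsLink.aemeasurable_summand (hlink : IsLink N₀ h w μ) {κ : Measure ℝ}
    (hκ : ∀ i, HasLaw (gain h m n l i) κ μ) (o : Option (Fin N)) :
    AEMeasurable (summand Es h w m n l o) μ := by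
  rcases o with _ | i
  · exact (hlink.hasLaw_re_noise l).aemeasurable
  · exact (hκ i).aemeasurable.const_mul _

lemma IsLink.aemeasurable_received (hlink : IsLink N₀ h w μ) {κ : Measure ℝ}
    (hκ : ∀ i, HasLaw (gain h m n l i) κ μ) : AEMeasurable (received Es h w m n l) μ := by
  rw [received_eq_sum_summand]
  exact Finset.aemeasurable_fun_sum _ fun o _ ↦ hlink.aemeasurable_summand hκ o

/-- The gain law `κ` is left general so as to serve both the matched and the mismatched antenna. -/
lemma IsLink.charFun_received (hlink : IsLink N₀ h w μ) (hmn : m ≠ n) (hl : l = m ∨ l = n)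
    {κ : Measure ℝ} (hκ : ∀ i, HasLaw (gain h m n l i) κ μ) (t : ℝ) :
    charFun (μ.map (received Es h w m n l)) t
      = charFun κ (√(Es : ℝ) * t) ^ N * Complex.exp (-(N₀ / 4 * t ^ 2 : ℝ)) := by
  have := hlink.indep.isProbabilityMeasure
  rw [received_eq_sum_summand, (hlink.iIndepFun_summand hmn hl).charFun_map_fun_sum_eq_prod
    (hlink.aemeasurable_summand hκ), Finset.prod_apply, Fintype.prod_option]
  simp only [summand]
  rw [(hlink.hasLaw_re_noise l).map_eq, charFun_gaussianReal, mul_comm]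
  congr 1
  · have (i : Fin N) : charFun (μ.map fun ω ↦ √(Es : ℝ) * gain h m n l i ω) t
        = charFun κ (√(Es : ℝ) * t) := by
      rw [charFun_map_mul_comp (hκ i).aemeasurable, (hκ i).map_eq]
    simp [this]
  · congr 1
    push_cast
    ring

lemma IsLink.memLp_summand (hlink : IsLink N₀ h w μ) {κ : Measure ℝ}
    (hκ : ∀ i, HasLaw (gain h m n l i) κ μ) (hL : MemLp id 2 κ) (o : Option (Fin N)) :
    MemLp (summand Es h w m n l o) 2 μ := by
  rcases o with _ | i
  · have hG := memLp_id_gaussianReal (μ := 0) (v := N₀ / 2) 2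
    rw [← (hlink.hasLaw_re_noise l).map_eq] at hG
    exact hG.comp_of_map (hlink.hasLaw_re_noise l).aemeasurable
  · rw [← (hκ i).map_eq] at hL
    exact (hL.comp_of_map (hκ i).aemeasurable).const_mul _

lemma IsLink.memLp_received (hlink : IsLink N₀ h w μ) {κ : Measure ℝ}
    (hκ : ∀ i, HasLaw (gain h m n l i) κ μ) (hL : MemLp id 2 κ) :
    MemLp (received Es h w m n l) 2 μ := by
  rw [received_eq_sum_summand]
  exact memLp_finsetSum _ fun o _ ↦ hlink.memLp_summand hκ hL o

lemma IsLink.integral_received (hlink : IsLink N₀ h w μ) {κ : Measure ℝ}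
    (hκ : ∀ i, HasLaw (gain h m n l i) κ μ) (hL : MemLp id 2 κ) :
    ∫ ω, received Es h w m n l ω ∂μ = N * (√(Es : ℝ) * ∫ x, x ∂κ) := by
  have := hlink.indep.isProbabilityMeasure
  rw [received_eq_sum_summand, integral_finsetSum _ fun o _ ↦
    (hlink.memLp_summand hκ hL o).integrable one_le_two, Fintype.sum_option]
  simp only [summand]
  rw [(hlink.hasLaw_re_noise l).integral_eq, integral_id_gaussianReal]
  have (i : Fin N) : ∫ ω, √(Es : ℝ) * gain h m n l i ω ∂μ = √(Es : ℝ) * ∫ x, x ∂κ := by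
    rw [integral_const_mul, (hκ i).integral_eq]
  simp [this]

lemma IsLink.variance_received (hlink : IsLink N₀ h w μ) (hmn : m ≠ n) (hl : l = m ∨ l = n)
    {κ : Measure ℝ} (hκ : ∀ i, HasLaw (gain h m n l i) κ μ) (hL : MemLp id 2 κ) :
    Var[received Es h w m n l; μ] = N * (Es * Var[id; κ]) + N₀ / 2 := by
  have := hlink.indep.isProbabilityMeasure
  have hsum : received Es h w m n l = ∑ o, summand Es h w m n l o := by
    rw [received_eq_sum_summand]
    funext ω
    simp
  rw [hsum, IndepFun.variance_sum (fun o _ ↦ hlink.memLp_summand hκ hL o)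
    (fun o _ o' _ hne ↦ (hlink.iIndepFun_summand hmn hl).indepFun hne), Fintype.sum_option]
  simp only [summand]
  rw [(hlink.hasLaw_re_noise l).variance_eq, variance_id_gaussianReal]
  have (i : Fin N) : Var[fun ω ↦ √(Es : ℝ) * gain h m n l i ω; μ] = Es * Var[id; κ] := by
    rw [variance_const_mul, (hκ i).variance_eq, Real.sq_sqrt Es.coe_nonneg]
  simp [this, add_comm]

end Link

/-! ### Central limit theorem. -/

/-- The central limit theorem for characteristic functions, with general scaling factors. -/
lemma tendsto_charFun_centered_pow {κ : Measure ℝ} [IsProbabilityMeasure κ] (hL : MemLp id 2 κ)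
    (hv : 0 < Var[id; κ]) {u : ℕ → ℝ} {t : ℝ}
    (hu : Tendsto (fun N : ℕ ↦ N * (u N ^ 2 * Var[id; κ])) atTop (𝓝 (t ^ 2))) :
    Tendsto (fun N : ℕ ↦
      (charFun κ (u N) * Complex.exp (-(u N * ∫ x, x ∂κ : ℝ) * I)) ^ N) atTop
      (𝓝 (Complex.exp (-t ^ 2 / 2))) := by
  set v := Var[id; κ] with hv_def
  set a := ∫ x, x ∂κ with ha
  -- Standardising reduces to mean `0` and variance `1`, where the expansion is `1 - y ^ 2 / 2 + o(y
  -- ^ 2)`.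
  let X : ℝ → ℝ := fun x ↦ (√v)⁻¹ * (x + -a)
  have hs : 0 < √v := Real.sqrt_pos.2 hv
  have hmean : κ[X] = 0 := by
    simp only [X]
    rw [integral_const_mul, integral_add (show Integrable (fun x : ℝ ↦ x) κ from hL.integrable one_le_two)
      (integrable_const _), ← ha]
    simp
  have hvar : κ[X ^ 2] = 1 := by
    have h1 : Var[X; κ] = 1 := by
      simp only [X]
      rw [variance_const_mul, variance_add_const (X := fun x : ℝ ↦ x) hL.aestronglyMeasurable]
      change _ * v = 1
      rw [inv_pow, Real.sq_sqrt hv.le, inv_mul_cancel₀ hv.ne']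
    rwa [variance_of_integral_eq_zero (by fun_prop) hmean] at h1
  have hchar (y : ℝ) : charFun (κ.map X) (√v * y)
      = charFun κ y * Complex.exp (-(y * a : ℝ) * I) := by
    simp only [X]
    rw [charFun_map_mul_comp (by fun_prop), inv_mul_cancel_left₀ hs.ne', charFun_map_add_const]
    simp [mul_comm]
  simp_rw [← hchar]
  set y : ℕ → ℝ := fun N ↦ √v * u N with hy
  have hy2 (N : ℕ) : y N ^ 2 = u N ^ 2 * v := by
    rw [hy, mul_pow, Real.sq_sqrt hv.le, mul_comm]
  simp_rw [← hy2] at hu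
  have hinv : Tendsto (fun N : ℕ ↦ 1 / (N : ℝ)) atTop (𝓝 0) := tendsto_one_div_atTop_nhds_zero_nat
  -- As `N * y N ^ 2` converges, it is bounded; an error `o(y ^ 2)` is therefore `o(1 / N)`.
  have hyO : (fun N ↦ y N ^ 2) =O[atTop] fun N : ℕ ↦ 1 / (N : ℝ) := by
    have := (hu.isBigO_one ℝ).mul (Asymptotics.isBigO_refl (fun N : ℕ ↦ 1 / (N : ℝ)) atTop)
    refine (this.congr' ?_ (.of_forall fun N ↦ one_mul _))
    filter_upwards [eventually_ne_atTop 0] with N hN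
    have : (N : ℝ) ≠ 0 := by exact_mod_cast hN
    field_simp
  have hy0 : Tendsto y atTop (𝓝 0) := by
    have := hyO.trans_tendsto hinv
    rw [tendsto_zero_iff_abs_tendsto_zero]
    simpa [Function.comp_def, Real.sqrt_sq_eq_abs] using
      (Real.continuous_sqrt.tendsto 0).comp this
  apply Complex.tendsto_pow_exp_of_isLittleO_sub_add_div
  have hnorm : (fun N : ℕ ↦ ‖(1 / N : ℂ)‖) = fun N : ℕ ↦ ‖(1 / N : ℝ)‖ := by simp
  rw [← Asymptotics.isLittleO_norm_right, hnorm, Asymptotics.isLittleO_norm_right]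
  have h1 := ((taylor_charFun_two (by fun_prop) hmean hvar).comp_tendsto hy0).trans_isBigO hyO
  -- This is the cost of replacing `y N ^ 2 / 2` by `t ^ 2 / (2 * N)`.
  have h2 : (fun N : ℕ ↦ (((t ^ 2 - N * y N ^ 2) / 2 * (1 / N) : ℝ) : ℂ))
      =o[atTop] fun N : ℕ ↦ 1 / (N : ℝ) := by
    rw [← Asymptotics.isLittleO_norm_left]
    simp_rw [Complex.norm_real]
    rw [Asymptotics.isLittleO_norm_left]
    have h0 : Tendsto (fun N : ℕ ↦ (t ^ 2 - N * y N ^ 2) / 2) atTop (𝓝 0) := by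
      have := (hu.const_sub (t ^ 2)).div_const 2
      rwa [sub_self, zero_div] at this
    have := ((Asymptotics.isLittleO_one_iff ℝ).2 h0).mul_isBigO
      (Asymptotics.isBigO_refl (fun N : ℕ ↦ 1 / (N : ℝ)) atTop)
    simpa using this
  refine (h1.add h2).congr' ?_ .rfl
  filter_upwards [eventually_ne_atTop 0] with N hN
  have : (N : ℂ) ≠ 0 := by exact_mod_cast hN
  simp only [Function.comp_apply]
  push_cast
  field_simp
  ring

/-! ### Closed form of `Ŷ_i` and exact law of `Z₂`. -/

lemma gain_right_eq {Ω : Type*} {Nr N : ℕ} (h : Fin Nr → Fin N → Ω → ℂ) (m n : Fin Nr)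
    (i : Fin N) (ω : Ω) :
    gain h m n n i ω
      = ((h n i ω).re * ((h m i ω).re + (h n i ω).im)
          - (h n i ω).im * (-(h m i ω).im + (h n i ω).re))
        / √(((h m i ω).re + (h n i ω).im) ^ 2 + (-(h m i ω).im + (h n i ω).re) ^ 2) := by
  set A := (h m i ω).re
  set B := (h n i ω).im
  set C := -(h m i ω).im
  set D := (h n i ω).re
  have hu : 1 / 2 * A + (1 - 1 / 2) * B = (A + B) / 2 := by ring
  have hv : 1 / 2 * C + (1 - 1 / 2) * D = (C + D) / 2 := by ring
  have hR : √(((A + B) / 2) ^ 2 + ((C + D) / 2) ^ 2) = √((A + B) ^ 2 + (C + D) ^ 2) / 2 := by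
    rw [div_pow, div_pow, ← add_div, Real.sqrt_div' _ (by positivity),
      Real.sqrt_sq zero_le_two]
  have hg : gain h m n n i ω
      = D * ((A + B) / 2 / √(((A + B) / 2) ^ 2 + ((C + D) / 2) ^ 2))
        - B * ((C + D) / 2 / √(((A + B) / 2) ^ 2 + ((C + D) / 2) ^ 2)) := by
    rw [← hu, ← hv]
    rfl
  -- Only `2 ≠ 0` is needed: when the root vanishes, both sides are `0` by the convention for
  -- division.
  rw [hg, hR, div_div_div_cancel_right₀ two_ne_zero, div_div_div_cancel_right₀ two_ne_zero]
  ring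

lemma IsLink.hasLaw_received_right {Ω : Type*} [MeasurableSpace Ω] {Nr N : ℕ} {Es N₀ : ℝ≥0}
    {h : Fin Nr → Fin N → Ω → ℂ} {w : Fin Nr → Ω → ℂ} {μ : Measure Ω} {m n : Fin Nr}
    (hlink : IsLink N₀ h w μ) (hmn : m ≠ n) :
    HasLaw (received Es h w m n n) (gaussianReal 0 (N * Es / 4 + N₀ / 2)) μ where
  aemeasurable := hlink.aemeasurable_received (hlink.hasLaw_gain_right hmn)
  map_eq := by
    have := hlink.indep.isProbabilityMeasure
    refine Measure.ext_of_charFun (funext fun t ↦ ?_)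
    rw [hlink.charFun_received hmn (.inr rfl) (hlink.hasLaw_gain_right hmn),
      charFun_gaussianReal, charFun_gaussianReal, ← Complex.exp_nat_mul, ← Complex.exp_add]
    have hE : ((√(Es : ℝ) : ℝ) : ℂ) ^ 2 = (Es : ℝ) := by
      rw [← Complex.ofReal_pow, Real.sq_sqrt Es.coe_nonneg]
    congr 1
    push_cast
    rw [mul_pow, hE]
    ring

/-! ### Asymptotic normality of `Z₁`. -/

lemma tendsto_natCast_mul_div_add {c d : ℝ} (hc : 0 < c) (hd : 0 ≤ d) :
    Tendsto (fun N : ℕ ↦ N * c / (N * c + d)) atTop (𝓝 1) := by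
  have h1 : Tendsto (fun N : ℕ ↦ (N : ℝ) * c + d) atTop atTop :=
    tendsto_atTop_add_const_right _ _ (tendsto_natCast_atTop_atTop.atTop_mul_const hc)
  have h2 : Tendsto (fun N : ℕ ↦ 1 - d / (N * c + d)) atTop (𝓝 1) := by
    simpa using (h1.const_div_atTop d).const_sub 1
  refine h2.congr' ?_
  -- For `N = 0` and `d = 0` the quotient is `0 / 0`, so the identity is only eventual.
  filter_upwards [eventually_ge_atTop 1] with N hN
  have : (0 : ℝ) < N := by exact_mod_cast hN
  have : 0 < N * c + d := by positivity
  field_simp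
  ring

/-- Asymptotic normality of the received signal at the antenna to which the surface is matched. -/
lemma tendstoInDistribution_received_left {Nr : ℕ} (Es N₀ : ℝ≥0) (hEs : 0 < Es)
    (Ω : ℕ → Type*) [∀ N, MeasurableSpace (Ω N)]
    (μ : (N : ℕ) → Measure (Ω N)) [∀ N, IsProbabilityMeasure (μ N)]
    (h : (N : ℕ) → Fin Nr → Fin N → Ω N → ℂ) (w : (N : ℕ) → Fin Nr → Ω N → ℂ)
    (hlink : ∀ N, IsLink N₀ (h N) (w N) (μ N)) {m n : Fin Nr} (hmn : m ≠ n) :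
    TendstoInDistribution
      (fun (N : ℕ) (ω : Ω N) ↦
        (received Es (h N) (w N) m n m ω - N * √(Real.pi * Es) / (2 * √2))
          / √(N * (6 - Real.pi) * Es / 8 + N₀ / 2))
      atTop (id : ℝ → ℝ) μ (gaussianReal 0 1) := by
  have hR (N : ℕ) := (hlink N).aemeasurable_received (Es := Es) ((hlink N).hasLaw_gain_left hmn)
  have hπ : 0 < 6 - Real.pi := by linarith [Real.pi_lt_four]
  have hE : (0 : ℝ) < Es := hEs
  set v := Var[id; matchedLaw] with hv
  have hv0 : 0 < v := by rw [hv, variance_id_matchedLaw]; positivity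
  set s : ℕ → ℝ := fun N ↦ √(N * (6 - Real.pi) * Es / 8 + N₀ / 2) with hs
  have hs2 (N : ℕ) : s N ^ 2 = N * (Es * v) + N₀ / 2 := by
    rw [hs, Real.sq_sqrt (by positivity), hv, variance_id_matchedLaw]; ring
  have hs_top : Tendsto (fun N ↦ s N ^ 2) atTop atTop := by
    simp_rw [hs2]
    exact tendsto_atTop_add_const_right _ _
      (tendsto_natCast_atTop_atTop.atTop_mul_const (by positivity))
  refine ⟨fun N ↦ ((hR N).sub_const _).div_const _, aemeasurable_id, ?_⟩
  refine ProbabilityMeasure.tendsto_iff_tendsto_charFun.2 fun t ↦ ?_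
  simp only [ProbabilityMeasure.coe_mk, Measure.map_id]
  rw [charFun_gaussianReal]
  set a := ∫ x, x ∂matchedLaw with ha
  -- The noise is centred, so the centring splits evenly over the `N` gain factors and the noise
  -- stays a separate Gaussian factor.
  have hchar (N : ℕ) : charFun ((μ N).map fun ω ↦
        (received Es (h N) (w N) m n m ω - N * √(Real.pi * Es) / (2 * √2)) / s N) t
      = (charFun matchedLaw (√(Es : ℝ) * ((s N)⁻¹ * t))
          * Complex.exp (-(√(Es : ℝ) * ((s N)⁻¹ * t) * a : ℝ) * I)) ^ N
        * Complex.exp (-(N₀ / 4 * ((s N)⁻¹ * t) ^ 2 : ℝ)) := by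
    have hf : (fun ω ↦ (received Es (h N) (w N) m n m ω - N * √(Real.pi * Es) / (2 * √2)) / s N)
        = fun ω ↦ (s N)⁻¹ * (received Es (h N) (w N) m n m ω + -(N * (√(Es : ℝ) * a))) := by
      funext ω
      rw [ha, integral_id_matchedLaw, Real.sqrt_mul Real.pi_nonneg]
      ring
    rw [hf, charFun_map_mul_comp ((hR N).add_const _)]
    have hc := charFun_map_add_const (μ := (μ N).map (received Es (h N) (w N) m n m))
      (-(N * (√(Es : ℝ) * a))) ((s N)⁻¹ * t)
    rw [AEMeasurable.map_map_of_aemeasurable (by fun_prop) (hR N)] at hc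
    refine hc.trans ?_
    rw [(hlink N).charFun_received hmn (.inl rfl) ((hlink N).hasLaw_gain_left hmn)]
    generalize (s N)⁻¹ * t = y
    rw [mul_pow (charFun _ _),
      ← Complex.exp_nat_mul, mul_right_comm]
    congr 3
    simp
    ring
  -- The normalisation includes the noise variance, so `N * u ^ 2 * v` equals `t ^ 2` only in the
  -- limit; this is why general scaling factors are needed.
  have hu : Tendsto (fun N : ℕ ↦ N * ((√(Es : ℝ) * ((s N)⁻¹ * t)) ^ 2 * v)) atTop
      (𝓝 (t ^ 2)) := by
    have := (tendsto_natCast_mul_div_add (c := Es * v) (d := N₀ / 2) (by positivity)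
      (by positivity)).const_mul (t ^ 2)
    rw [mul_one] at this
    refine this.congr fun N ↦ ?_
    rw [← hs2, mul_pow, mul_pow, Real.sq_sqrt Es.coe_nonneg, inv_pow]
    ring
  have hnoise : Tendsto (fun N ↦ Complex.exp (-(N₀ / 4 * ((s N)⁻¹ * t) ^ 2 : ℝ))) atTop
      (𝓝 1) := by
    have h0 : Tendsto (fun N ↦ -(N₀ / 4 * ((s N)⁻¹ * t) ^ 2 : ℝ)) atTop (𝓝 0) := by
      have := ((hs_top.inv_tendsto_atTop.mul_const (t ^ 2)).const_mul (N₀ / 4 : ℝ)).neg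
      simp only [zero_mul, mul_zero, neg_zero] at this
      refine this.congr fun N ↦ ?_
      simp [mul_pow]
    have := (Complex.continuous_exp.tendsto _).comp
      ((Complex.continuous_ofReal.tendsto _).comp h0)
    simpa [Function.comp_def] using this
  have hmain := (tendsto_charFun_centered_pow memLp_id_matchedLaw hv0 hu).mul hnoise
  have hlim : Complex.exp (t * (0 : ℝ) * I - (1 : ℝ≥0) * t ^ 2 / 2)
      = Complex.exp (-t ^ 2 / 2) * 1 := by
    rw [mul_one]
    congr 1
    simp
    ring
  rw [hlim]
  exact hmain.congr fun N ↦ (hchar N).symm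

end RISRQSSK

theorem theorem2 {Nr : ℕ} (Es N₀ : ℝ≥0) (hEs : 0 < Es)
    (Ω : ℕ → Type*) [∀ N, MeasurableSpace (Ω N)]
    (μ : (N : ℕ) → Measure (Ω N)) [∀ N, IsProbabilityMeasure (μ N)]
    (h : (N : ℕ) → Fin Nr → Fin N → Ω N → ℂ) (w : (N : ℕ) → Fin Nr → Ω N → ℂ)
    (hlink : ∀ N, RISRQSSK.IsLink N₀ (h N) (w N) (μ N))
    (m n mhat : Fin Nr) (hmn : m ≠ n) (hmhat : mhat = n) :
    -- closed form, mean and variance of each `Ŷ_i`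
    (∀ (N : ℕ) (i : Fin N),
      (∀ ω,
        let A := (h N m i ω).re
        let B := (h N n i ω).im
        let C := -(h N m i ω).im
        let D := (h N n i ω).re
        RISRQSSK.gain (h N) m n mhat i ω
          = (D * (A + B) - B * (C + D)) / √((A + B) ^ 2 + (C + D) ^ 2)) ∧
      MemLp (RISRQSSK.gain (h N) m n mhat i) 2 (μ N) ∧
      (∫ ω, RISRQSSK.gain (h N) m n mhat i ω ∂(μ N)) = 0 ∧
      variance (RISRQSSK.gain (h N) m n mhat i) (μ N) = 1 / 4) ∧
    -- `Z₂` is normal, for every number `N` of reflecting elements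
    (∀ N : ℕ,
      HasLaw (RISRQSSK.received Es (h N) (w N) m n mhat)
        (gaussianReal 0 (N * Es / 4 + N₀ / 2)) (μ N)) ∧
    -- mean and variance of `Z₁`, for every number `N` of reflecting elements
    (∀ N : ℕ,
      MemLp (RISRQSSK.received Es (h N) (w N) m n m) 2 (μ N) ∧
      (∫ ω, RISRQSSK.received Es (h N) (w N) m n m ω ∂(μ N))
        = N * √(Real.pi * Es) / (2 * √2) ∧
      variance (RISRQSSK.received Es (h N) (w N) m n m) (μ N)
        = N * (6 - Real.pi) * Es / 8 + N₀ / 2) ∧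
    -- `Z₁` is asymptotically normal with that mean and variance as `N → ∞`
    TendstoInDistribution
      (fun (N : ℕ) (ω : Ω N) =>
        (RISRQSSK.received Es (h N) (w N) m n m ω - N * √(Real.pi * Es) / (2 * √2))
          / √(N * (6 - Real.pi) * Es / 8 + N₀ / 2))
      atTop (id : ℝ → ℝ) μ (gaussianReal 0 1) := by
  subst hmhat
  refine ⟨fun N i ↦ ?_, fun N ↦ (hlink N).hasLaw_received_right hmn, fun N ↦ ?_,
    RISRQSSK.tendstoInDistribution_received_left Es N₀ hEs Ω μ h w hlink hmn⟩
  · have hlaw := (hlink N).hasLaw_gain_right hmn i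
    refine ⟨fun ω ↦ RISRQSSK.gain_right_eq (h N) m mhat i ω, ?_, ?_, ?_⟩
    · have hG := memLp_id_gaussianReal (μ := 0) (v := 1 / 4) 2
      rw [← hlaw.map_eq] at hG
      exact hG.comp_of_map hlaw.aemeasurable
    · rw [hlaw.integral_eq, integral_id_gaussianReal]
    · rw [hlaw.variance_eq, variance_id_gaussianReal]
      norm_num
  · have hlaw := (hlink N).hasLaw_gain_left hmn
    refine ⟨(hlink N).memLp_received hlaw RISRQSSK.memLp_id_matchedLaw, ?_, ?_⟩
    · rw [(hlink N).integral_received hlaw RISRQSSK.memLp_id_matchedLaw,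
        RISRQSSK.integral_id_matchedLaw, Real.sqrt_mul Real.pi_nonneg]
      ring
    · rw [(hlink N).variance_received hmn (.inl rfl) hlaw RISRQSSK.memLp_id_matchedLaw,
        RISRQSSK.variance_id_matchedLaw]
      ring
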